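/- Let $K\ge 1$, let $\mathcal S\subset\mathbb C$ be a finite signal set with at least two points, let $f:\mathcal S^K\to\mathcal S$, and let $a_i,b_i\in\mathbb C$ $(1\le i\le K)$ satisfy $|a_i|^2+|b_i|^2=1$ and $a_i\ne 0$. Let the fade coefficients $h_{S_iR}\sim\mathcal{CN}(0,\sigma_{S_iR}^2)$, $h_{S_iD}\sim\mathcal{CN}(0,\sigma_{S_iD}^2)$, $h_{RD}\sim\mathcal{CN}(0,\sigma_{RD}^2)$ (all variances positive) and the noises $z_R,z_{D_1},z_{D_2}\sim\mathcal{CN}(0,1)$ be independent. For $\mathrm{SNR}=E_s>0$ and $x=(x_1,\dots,x_K)\in\mathcal S^K$, the proposed two-phase scheme for the $K$-user multiple access relay channel is as follows. Phase 1: the sources transmit, the relay $R$ receives $y_R=\sum_i h_{S_iR}\sqrt{E_s}\,a_ix_i+z_R$ and the destination $D$ receives $y_{D_1}=\sum_i h_{S_iD}\sqrt{E_s}\,a_ix_i+z_{D_1}$. Knowing the $h_{S_iR}$, the relay computes a maximum likelihood estimate $\hat x^R\in\arg\min_{x'\in\mathcal S^K}\bigl|y_R-\sum_i h_{S_iR}\sqrt{E_s}\,a_ix'_i\bigr|$.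 Phase 2: $R$ transmits $x_R=f(\hat x^R)$ and $D$ receives $y_{D_2}=\sum_i h_{S_iD}\sqrt{E_s}\,b_ix_i+h_{RD}\sqrt{E_s}\,x_R+z_{D_2}$. For $x'\in\mathcal S^K$ and $r\in\mathcal S$ put $$m(x',r)=\Bigl|y_{D_1}-\sum_i h_{S_iD}\sqrt{E_s}\,a_ix'_i\Bigr|^2+\Bigl|y_{D_2}-\sum_i h_{S_iD}\sqrt{E_s}\,b_ix'_i-h_{RD}\sqrt{E_s}\,r\Bigr|^2,$$ $m_1(x')=m(x',f(x'))$ and $m_2(x')=\min_{r\in\mathcal S,\,r\ne f(x')}m(x',r)$. The proposed decoder at $D$, which knows the $h_{S_iD}$ and $h_{RD}$, outputs a minimiser $\hat x^D$ over $x'\in\mathcal S^K$ of $\min\{m_1(x'),\ \log(\mathrm{SNR})+m_2(x')\}$. Ties are broken by any measurable rules. Suppose that 1. $f$ is a $K$-dimensional Latin hypercube, i.e. two tuples that differ in exactly one coordinate have different images under $f$; 2. for all nonzero $\Delta x_1,\dots,\Delta x_K\in\{s-s': s,s'\in\mathcal S\}$, every $2\times 2$ submatrix of the $K\times 2$ matrix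 $C_r(\Delta x_1,\dots,\Delta x_K)$ with rows $(a_i\Delta x_i,\ b_i\Delta x_i)$ has rank two. Then the proposed decoder achieves the maximum diversity order two. That is, $$\lim_{\mathrm{SNR}\to\infty}\frac{-\log P(\mathrm{SNR})}{\log \mathrm{SNR}}=2$$ where $P(\mathrm{SNR})$ is the probability of $\hat x^D\ne x$, both for each fixed transmitted tuple $x\in\mathcal S^K$ and averaged over equiprobable $x$. Moreover, for any measurable relay decision rule $\hat x^R$ (a function of SNR, the $h_{S_iR}$ and $y_R$) and any measurable destination decision rule $\hat x^D$ (a function of SNR, the $h_{S_iD}$, $h_{RD}$, $y_{D_1}$ and $y_{D_2}$) in place of the above, the averaged error probability has diversity order at most two: for every $\varepsilon>0$ it is at least $\mathrm{SNR}^{-(2+\varepsilon)}$ for all sufficiently large SNR. -/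

import Mathlib

open MeasureTheory ProbabilityTheory Filter Topology
open scoped NNReal

noncomputable section

namespace MARC

/-- The circularly symmetric complex Gaussian law `CN(0, v)`: independent real and imaginary parts,
each of law `N(0, v / 2)`. -/
def complexGaussian (v : ℝ≥0) : Measure ℂ :=
  ((gaussianReal 0 (v / 2)).prod (gaussianReal 0 (v / 2))).map
    (fun p : ℝ × ℝ => (p.1 : ℂ) + (p.2 : ℂ) * Complex.I)

instance (v : ℝ≥0) : IsProbabilityMeasure (complexGaussian v) :=
  Measure.isProbabilityMeasure_map (by fun_prop)

/-- The parameters of the two-phase scheme for the `K`-user multiple access relay channel. -/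
structure Network (K : ℕ) where
  /-- the signal set -/
  S : Finset ℂ
  /-- the scaling constants of the sources in phase 1 -/
  a : Fin K → ℂ
  /-- the scaling constants of the sources in phase 2 -/
  b : Fin K → ℂ
  /-- the network coding map of the relay -/
  f : (Fin K → S) → S
  /-- the variances of the fade coefficients of the source-relay links -/
  varSR : Fin K → ℝ≥0
  /-- the variances of the fade coefficients of the source-destination links -/
  varSD : Fin K → ℝ≥0
  /-- the variance of the fade coefficient of the relay-destination link -/
  varRD : ℝ≥0

namespace Network

variable {K : ℕ} (N : Network K)

/-- A tuple `(x₁, …, x_K)` of transmitted symbols. -/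
abbrev Message : Type := Fin K → N.S

/-- The noiseless signal received in phase 1 (at the relay or at the destination) through the fade
coefficients `h`, when the sources transmit `x` with energy `snr`. -/
def phase1 (snr : ℝ) (h : Fin K → ℂ) (x : N.Message) : ℂ :=
  ∑ i, h i * (√snr : ℂ) * N.a i * (x i : ℂ)

/-- The noiseless signal received at the destination in phase 2, when the sources transmit `x` and
the relay transmits `r`. -/
def phase2 (snr : ℝ) (h : Fin K → ℂ) (hRD : ℂ) (x : N.Message) (r : N.S) : ℂ :=
  ∑ i, h i * (√snr : ℂ) * N.b i * (x i : ℂ) + hRD * (√snr : ℂ) * (r : ℂ)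

/-- The metric `m₁`. -/
def m1 (snr : ℝ) (h : Fin K → ℂ) (hRD y₁ y₂ : ℂ) (x : N.Message) : ℝ :=
  ‖y₁ - N.phase1 snr h x‖ ^ 2 + ‖y₂ - N.phase2 snr h hRD x (N.f x)‖ ^ 2

/-- The metric `m₂`, with a minimum over the relay symbols different from `f x`. -/
def m2 (snr : ℝ) (h : Fin K → ℂ) (hRD y₁ y₂ : ℂ) (x : N.Message) : ℝ :=
  ‖y₁ - N.phase1 snr h x‖ ^ 2 +
    ⨅ r : {r : N.S // r ≠ N.f x}, ‖y₂ - N.phase2 snr h hRD x r‖ ^ 2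

/-- The decoding metric of the proposed decoder. -/
def metric (snr : ℝ) (h : Fin K → ℂ) (hRD y₁ y₂ : ℂ) (x : N.Message) : ℝ :=
  min (N.m1 snr h hRD y₁ y₂ x) (Real.log snr + N.m2 snr h hRD y₁ y₂ x)

/-- A decision rule at the relay: for each SNR, an estimate of the transmitted tuple from the fade
coefficients of the source-relay links and the received signal `y_R`. -/
structure RelayRule where
  decide : ℝ → (Fin K → ℂ) × ℂ → N.Message
  measurable_decide : ∀ snr, Measurable (decide snr)

/-- A decision rule at the destination: for each SNR, an estimate of the transmitted tuple from the
fade coefficients `(h_{S_iD})_i`, `h_{RD}` and the received signals `y_{D₁}`, `y_{D₂}`. -/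
structure DestRule where
  decide : ℝ → (Fin K → ℂ) × ℂ × ℂ × ℂ → N.Message
  measurable_decide : ∀ snr, Measurable (decide snr)

variable {N}

/-- The relay rule is maximum likelihood decoding (ties are broken in any way). -/
def RelayRule.IsML (δ : N.RelayRule) : Prop :=
  ∀ snr : ℝ, 0 < snr → ∀ (h : Fin K → ℂ) (y : ℂ) (x' : N.Message),
    ‖y - N.phase1 snr h (δ.decide snr (h, y))‖ ≤ ‖y - N.phase1 snr h x'‖

/-- The destination rule minimises `min (m₁, log SNR + m₂)` (ties are broken in any way). -/
def DestRule.IsProposed (δ : N.DestRule) : Prop :=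
  ∀ snr : ℝ, 0 < snr → ∀ (h : Fin K → ℂ) (hRD y₁ y₂ : ℂ) (x' : N.Message),
    N.metric snr h hRD y₁ y₂ (δ.decide snr (h, hRD, y₁, y₂)) ≤ N.metric snr h hRD y₁ y₂ x'

variable (N)

/-- Realisations `((h_{S_iR})_i, z_R)` of the fading and the noise at the relay, and
`((h_{S_iD})_i, h_{RD}, z_{D₁}, z_{D₂})` of the fading and the noise at the destination. -/
abbrev Outcome (K : ℕ) : Type :=
  ((Fin K → ℂ) × ℂ) × ((Fin K → ℂ) × ℂ × ℂ × ℂ)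

/-- The joint law of fading and noise: all coefficients are independent, the noises have
variance 1. -/
def law : Measure (Outcome K) :=
  ((Measure.pi fun i => complexGaussian (N.varSR i)).prod (complexGaussian 1)).prod
    ((Measure.pi fun i => complexGaussian (N.varSD i)).prod
      ((complexGaussian N.varRD).prod ((complexGaussian 1).prod (complexGaussian 1))))

variable {N}

/-- The symbol that the relay transmits in phase 2, when the sources transmit `x`, the fade
coefficients of the source-relay links are `h` and the noise at the relay is `z`. -/
def relaySymbol (δR : N.RelayRule) (snr : ℝ) (x : N.Message) (h : Fin K → ℂ) (z : ℂ) : N.S :=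
  N.f (δR.decide snr (h, N.phase1 snr h x + z))

/-- The tuple decoded at the destination when the sources transmit `x`. -/
def decoded (δR : N.RelayRule) (δD : N.DestRule) (snr : ℝ) (x : N.Message) :
    Outcome K → N.Message
  | ((hSR, zR), (hSD, hRD, z₁, z₂)) =>
    δD.decide snr (hSD, hRD, N.phase1 snr hSD x + z₁,
      N.phase2 snr hSD hRD x (relaySymbol δR snr x hSR zR) + z₂)

/-- The probability that the destination decodes a wrong tuple, when the sources transmit `x`. -/
def errorProb (δR : N.RelayRule) (δD : N.DestRule) (x : N.Message) (snr : ℝ) : ℝ :=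
  N.law.real {ω | decoded δR δD snr x ω ≠ x}

/-- The error probability at the destination for equiprobable tuples. -/
def avgErrorProb (δR : N.RelayRule) (δD : N.DestRule) (snr : ℝ) : ℝ :=
  (∑ x : N.Message, errorProb δR δD x snr) / (Fintype.card N.Message : ℝ)

variable (N)

/-- The network coding map is injective in each coordinate (a Latin hypercube). -/
def IsLatinHypercube : Prop :=
  ∀ (x : N.Message) (i : Fin K) (s s' : N.S), s ≠ s' →
    N.f (Function.update x i s) ≠ N.f (Function.update x i s')

/-- The restricted codeword difference matrix `C_r(Δx₁, …, Δx_K)`. -/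
def restrictedDiff (Δ : Fin K → ℂ) : Matrix (Fin K) (Fin 2) ℂ :=
  Matrix.of fun i => ![N.a i * Δ i, N.b i * Δ i]

/-- All `2 × 2` submatrices of the matrices `C_r(Δx₁, …, Δx_K)` have rank two, whenever all the
`Δx_i` are nonzero differences of points of the signal set. -/
def FullRankSubmatrices : Prop :=
  ∀ Δ : Fin K → ℂ, (∀ i, (∃ s ∈ N.S, ∃ s' ∈ N.S, Δ i = s - s') ∧ Δ i ≠ 0) →
    ∀ i j : Fin K, i ≠ j → ((N.restrictedDiff Δ).submatrix ![i, j] id).rank = 2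

end Network

/-- The error probability `P` has diversity order `d`:
`lim -log P(SNR) / log SNR = d` as `SNR → ∞`. -/
def HasDiversityOrder (P : ℝ → ℝ) (d : ℝ) : Prop :=
  Tendsto (fun snr => -Real.log (P snr) / Real.log snr) atTop (𝓝 d)

/-- The diversity order of `P` is at most `d`, that is `limsup -log P(SNR) / log SNR ≤ d`, written
without logarithms so that `P` may vanish. -/
def DiversityOrderAtMost (P : ℝ → ℝ) (d : ℝ) : Prop :=
  ∀ ε : ℝ, 0 < ε → ∀ᶠ snr in atTop, snr ^ (-(d + ε)) ≤ P snr

end MARC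

end

/-! Heuristically, each independent fade that must have size about `1/√s` (up to logarithms) costs a
factor `1/s`, and so does noise energy above `log s`. An error needs two such costs, and two can
suffice.

For the upper bound, noise energy above `2 log s` at the destination already has order two.
Otherwise a wrong `x'` can win only if some codeword `(x', r')` lies within squared distance `3 log
s` of the received signal, while the relay sent `r`. The phase 1 difference is then small, which
costs one fade. The second cost depends on the case (`orderAtLeast_confusion`): if `r ≠ f x`, the
relay has erred, independently of the destination fades; if `r = f x` and `r ≠ r'`, the fade `h_RD`
lies in a small disc given the others; if `r = r' = f x` and at least two coordinates differ, the
rank condition gives two independent small linear forms; if only one coordinate differs, the Latin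
property forces `r' ≠ f x'`, so `x'` carries the penalty `log s`, which noise must overcome.

For the lower bounds, take `x` and `x'` differing in one coordinate `i`. When `h_{S_iD}` and `h_RD`
are both of size `1/√s`, which has probability of order `s⁻²`, the two signals stay at bounded
distance whatever the relay sends. Any rule then errs with probability bounded below
(`exists_le_error_add_error`). For the proposed decoder, suitable noise produces the error for each
fixed `x` (`exists_le_error`). -/

noncomputable section

open scoped ENNReal

namespace MARC

/-! ### Small balls, tails and two-point testing for complex Gaussians. -/

/-- The density of `CN(0, v)` with respect to Lebesgue measure. -/
def complexGaussianPDF (v : ℝ≥0) (z : ℂ) : ℝ≥0∞ :=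
  ENNReal.ofReal ((Real.pi * v)⁻¹ * Real.exp (-‖z‖ ^ 2 / v))

@[fun_prop]
lemma measurable_complexGaussianPDF (v : ℝ≥0) : Measurable (complexGaussianPDF v) := by
  unfold complexGaussianPDF
  fun_prop

lemma gaussianPDF_mul_gaussianPDF {v : ℝ≥0} (hv : 0 < v) (z : ℂ) :
    gaussianPDF 0 (v / 2) z.re * gaussianPDF 0 (v / 2) z.im = complexGaussianPDF v z := by
  have hv' : (0 : ℝ) < v := hv
  rw [gaussianPDF, gaussianPDF, ← ENNReal.ofReal_mul (gaussianPDFReal_nonneg _ _ _),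
    complexGaussianPDF, gaussianPDFReal_def]
  congr 1
  have h1 : 2 * Real.pi * ((v / 2 : ℝ≥0) : ℝ) = Real.pi * v := by push_cast; ring
  have h2 : 2 * ((v / 2 : ℝ≥0) : ℝ) = v := by push_cast; ring
  have h3 : (√(Real.pi * v))⁻¹ * (√(Real.pi * v))⁻¹ = (Real.pi * v)⁻¹ := by
    rw [← mul_inv, Real.mul_self_sqrt (by positivity)]
  simp only [h1, h2, sub_zero]
  rw [mul_mul_mul_comm, h3, ← Real.exp_add, Complex.sq_norm, Complex.normSq_apply]
  congr 2
  ring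

lemma complexGaussian_eq_withDensity {v : ℝ≥0} (hv : 0 < v) :
    complexGaussian v = volume.withDensity (complexGaussianPDF v) := by
  have hv2 : v / 2 ≠ 0 := by positivity
  have hg : (fun p : ℝ × ℝ => (p.1 : ℂ) + (p.2 : ℂ) * Complex.I)
      = Complex.measurableEquivRealProd.symm := by
    ext p
    exact (Complex.mk_eq_add_mul_I p.1 p.2).symm
  ext s hs
  have hmp := Complex.volume_preserving_equiv_real_prod.symm
  rw [complexGaussian, hg, gaussianReal_of_var_ne_zero _ hv2,
    prod_withDensity (by fun_prop) (by fun_prop),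
    MeasurableEquiv.map_apply, withDensity_apply _ hs, withDensity_apply _
      (Complex.measurableEquivRealProd.symm.measurable hs),
    ← hmp.setLIntegral_comp_preimage_emb Complex.measurableEquivRealProd.symm.measurableEmbedding]
  refine lintegral_congr fun p => ?_
  rw [← gaussianPDF_mul_gaussianPDF hv]
  rfl

lemma complexGaussian_closedBall_le {v : ℝ≥0} (hv : 0 < v) :
    ∃ C : ℝ≥0∞, C ≠ ∞ ∧ ∀ (c : ℂ) (r : ℝ),
      complexGaussian v (Metric.closedBall c r) ≤ C * ENNReal.ofReal r ^ 2 := by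
  refine ⟨ENNReal.ofReal ((Real.pi * v)⁻¹) * NNReal.pi,
    ENNReal.mul_ne_top ENNReal.ofReal_ne_top ENNReal.coe_ne_top, fun c r => ?_⟩
  rw [complexGaussian_eq_withDensity hv, withDensity_apply _ Metric.isClosed_closedBall.measurableSet]
  calc ∫⁻ z in Metric.closedBall c r, complexGaussianPDF v z
      ≤ ∫⁻ _ in Metric.closedBall c r, ENNReal.ofReal ((Real.pi * v)⁻¹) := by
        refine lintegral_mono fun z => ENNReal.ofReal_le_ofReal ?_
        have : Real.exp (-‖z‖ ^ 2 / v) ≤ 1 := by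
          rw [Real.exp_le_one_iff, neg_div]
          exact neg_nonpos.2 (by positivity)
        exact mul_le_of_le_one_right (by positivity) this
    _ = _ := by
        rw [setLIntegral_const, Complex.volume_closedBall]
        ring

/-- On a bounded set the density is at least its value at radius `R`; all lower bounds on
probabilities rest on this. -/
lemma exists_smul_restrict_le_complexGaussian {v : ℝ≥0} (hv : 0 < v) (R : ℝ) :
    ∃ c : ℝ≥0∞, c ≠ 0 ∧ c • volume.restrict (Metric.closedBall (0 : ℂ) R) ≤ complexGaussian v := by
  have hv' : (0 : ℝ) < v := hv
  refine ⟨ENNReal.ofReal ((Real.pi * v)⁻¹ * Real.exp (-R ^ 2 / v)), ?_, ?_⟩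
  · rw [Ne, ENNReal.ofReal_eq_zero, not_le]
    positivity
  refine Measure.le_iff.2 fun s hs => ?_
  rw [complexGaussian_eq_withDensity hv, withDensity_apply _ hs, Measure.smul_apply,
    Measure.restrict_apply hs, smul_eq_mul, ← setLIntegral_const]
  refine (setLIntegral_mono (by fun_prop) fun z hz => ENNReal.ofReal_le_ofReal ?_).trans
    (lintegral_mono_set Set.inter_subset_left)
  have : ‖z‖ ≤ R := by simpa using hz.2
  have h0 := norm_nonneg z
  gcongr

lemma exists_le_complexGaussian_closedBall {v : ℝ≥0} (hv : 0 < v) (R : ℝ) :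
    ∃ c : ℝ≥0∞, c ≠ 0 ∧ ∀ (w : ℂ) (r : ℝ), ‖w‖ + r ≤ R →
      c * ENNReal.ofReal r ^ 2 ≤ complexGaussian v (Metric.closedBall w r) := by
  obtain ⟨c, hc, hle⟩ := exists_smul_restrict_le_complexGaussian hv R
  refine ⟨c * NNReal.pi, mul_ne_zero hc (by simp [NNReal.pi_ne_zero]), fun w r hr => ?_⟩
  refine le_trans (le_of_eq ?_) (hle _)
  rw [Measure.smul_apply, Measure.restrict_apply Metric.isClosed_closedBall.measurableSet,
    Set.inter_eq_left.2, Complex.volume_closedBall, smul_eq_mul]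
  · ring
  · exact Metric.closedBall_subset_closedBall' (by rw [dist_zero_right]; linarith)

lemma lintegral_exp_mul_sq_complexGaussian {l : ℝ} (hl : l < 1) :
    ∫⁻ z, ENNReal.ofReal (Real.exp (l * ‖z‖ ^ 2)) ∂complexGaussian 1 ≠ ∞ := by
  rw [complexGaussian_eq_withDensity one_pos,
    lintegral_withDensity_eq_lintegral_mul _ (by fun_prop) (by fun_prop)]
  have hl' : 0 < 1 - l := by linarith
  have hint : Integrable (fun z : ℂ => Real.exp (-(1 - l) * ‖z‖ ^ 2)) := by
    -- The integral of a non-integrable function is zero by convention, so the nonzero closed form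
    -- proves integrability.
    refine .of_integral_ne_zero ?_
    rw [GaussianFourier.integral_rexp_neg_mul_sq_norm hl']
    have := Real.pi_pos
    positivity
  have h := (hint.const_mul (Real.pi⁻¹)).lintegral_lt_top.ne
  refine ne_of_eq_of_ne (lintegral_congr fun z => ?_) h
  rw [Pi.mul_apply, complexGaussianPDF, ← ENNReal.ofReal_mul (by positivity)]
  congr 1
  rw [mul_assoc, ← Real.exp_add]
  simp only [NNReal.coe_one, mul_one, div_one]
  congr 2
  ring

/-- Chernoff's bound for the norm of a standard complex Gaussian vector of dimension two. -/
lemma exists_tail_bound_two {l : ℝ} (hl0 : 0 < l) (hl : l < 1) :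
    ∃ C : ℝ≥0∞, C ≠ ∞ ∧ ∀ t : ℝ,
      ((complexGaussian 1).prod (complexGaussian 1)) {z | t ≤ ‖z.1‖ ^ 2 + ‖z.2‖ ^ 2} ≤
        C * ENNReal.ofReal (Real.exp (-(l * t))) := by
  set A := ∫⁻ z, ENNReal.ofReal (Real.exp (l * ‖z‖ ^ 2)) ∂complexGaussian 1 with hA
  have hA' : A ≠ ∞ := lintegral_exp_mul_sq_complexGaussian hl
  refine ⟨A * A, ENNReal.mul_ne_top hA' hA', fun t => ?_⟩
  have hm := meas_ge_le_lintegral_div (μ := (complexGaussian 1).prod (complexGaussian 1))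
    (f := fun z => ENNReal.ofReal (Real.exp (l * ‖z.1‖ ^ 2)) *
      ENNReal.ofReal (Real.exp (l * ‖z.2‖ ^ 2))) (by fun_prop)
    (ε := ENNReal.ofReal (Real.exp (l * t))) (by simp [Real.exp_pos]) ENNReal.ofReal_ne_top
  rw [lintegral_prod_mul (f := fun z : ℂ => ENNReal.ofReal (Real.exp (l * ‖z‖ ^ 2)))
    (g := fun z : ℂ => ENNReal.ofReal (Real.exp (l * ‖z‖ ^ 2))) (by fun_prop) (by fun_prop), ← hA, ENNReal.div_eq_inv_mul, mul_comm _ (A * A),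
    ← ENNReal.ofReal_inv_of_pos (Real.exp_pos _), ← Real.exp_neg] at hm
  refine (measure_mono fun z hz => ?_).trans hm
  simp only [Set.mem_ofPred_eq] at hz ⊢
  rw [← ENNReal.ofReal_mul (Real.exp_pos _).le, ← Real.exp_add, ← mul_add]
  exact ENNReal.ofReal_le_ofReal (Real.exp_le_exp.2 (by gcongr))

lemma complexGaussian_tail_le (t : ℝ) :
    complexGaussian 1 {z | t ≤ ‖z‖ ^ 2} ≤
      ((complexGaussian 1).prod (complexGaussian 1)) {z | t ≤ ‖z.1‖ ^ 2 + ‖z.2‖ ^ 2} := by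
  rw [← mul_one (complexGaussian 1 _), ← measure_univ (μ := complexGaussian 1), ← Measure.prod_prod]
  refine measure_mono fun z hz => ?_
  have h1 : t ≤ ‖z.1‖ ^ 2 := hz.1
  have h2 := sq_nonneg ‖z.2‖
  simp only [Set.mem_ofPred_eq]
  linarith

/-- Two signals at bounded distance cannot be told apart reliably in Gaussian noise. -/
lemma exists_two_point_bound (R : ℝ) :
    ∃ c : ℝ≥0∞, c ≠ 0 ∧ ∀ m m' : ℂ × ℂ, dist m m' ≤ R → ∀ D : Set (ℂ × ℂ), MeasurableSet D →
      c ≤ ((complexGaussian 1).prod (complexGaussian 1)) {z | m + z ∈ D} +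
        ((complexGaussian 1).prod (complexGaussian 1)) {z | m' + z ∈ Dᶜ} := by
  obtain ⟨c, hc, hle⟩ := exists_smul_restrict_le_complexGaussian one_pos (R + 1)
  have : (volume : Measure (ℂ × ℂ)).IsAddHaarMeasure := Measure.prod.instIsAddHaarMeasure _ _
  set B : Set (ℂ × ℂ) := Metric.closedBall 0 (R + 1) with hB
  have hprod : (c * c) • volume.restrict B ≤ (complexGaussian 1).prod (complexGaussian 1) := by
    refine le_trans (le_of_eq ?_) (Measure.prod_mono hle hle)
    rw [Measure.prod_smul_left, Measure.prod_smul_right, Measure.prod_restrict, smul_smul,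
      closedBall_prod_same]
    rfl
  -- Every point of the unit ball about `n` is `m + z` with `‖z‖ ≤ R + 1`, where the noise law
  -- dominates Lebesgue measure. With `n = m'` for both signals, `D` and `Dᶜ` partition one common
  -- ball.
  have key : ∀ (m n : ℂ × ℂ), dist m n ≤ R → ∀ D : Set (ℂ × ℂ), MeasurableSet D →
      c * c * volume (D ∩ Metric.closedBall n 1) ≤
        ((complexGaussian 1).prod (complexGaussian 1)) {z | m + z ∈ D} := by
    intro m n hmn D hD
    refine le_trans ?_ (hprod _)
    have hD' : MeasurableSet {z | m + z ∈ D} := hD.preimage (by fun_prop)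
    rw [Measure.smul_apply, smul_eq_mul, Measure.restrict_apply hD',
      ← (measurePreserving_add_left volume m).measure_preimage
        (hD.inter Metric.isClosed_closedBall.measurableSet).nullMeasurableSet]
    gcongr
    rintro z ⟨hz, hz'⟩
    refine ⟨hz, ?_⟩
    rw [hB, mem_closedBall_zero_iff]
    rw [Metric.mem_closedBall, dist_eq_norm] at hz'
    rw [dist_eq_norm] at hmn
    calc ‖z‖ = ‖(m + z - n) - (m - n)‖ := by congr 1; abel
      _ ≤ ‖m + z - n‖ + ‖m - n‖ := norm_sub_le _ _
      _ ≤ R + 1 := by linarith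
  refine ⟨c * c * volume (Metric.closedBall (0 : ℂ × ℂ) 1), mul_ne_zero (mul_ne_zero hc hc)
    (Metric.measure_closedBall_pos _ _ one_pos).ne', fun m m' hm D hD => ?_⟩
  have hR : 0 ≤ R := dist_nonneg.trans hm
  refine le_trans ?_ (add_le_add (key m m' hm D hD) (key m' m' (by simpa) _ hD.compl))
  rw [← mul_add, Set.inter_comm, Set.inter_comm Dᶜ, ← Set.sdiff_eq, measure_inter_add_sdiff _ hD,
    Measure.addHaar_closedBall_center _ m']

/-! ### Calculus of decay orders. -/

/-- `P` decays at least like `SNR ^ (-d)`, up to factors of subpolynomial growth. -/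
def OrderAtLeast (P : ℝ → ℝ≥0∞) (d : ℝ) : Prop :=
  ∀ d' < d, ∀ᶠ s in atTop, P s ≤ ENNReal.ofReal (s ^ (-d'))

namespace OrderAtLeast

variable {P Q : ℝ → ℝ≥0∞} {d e : ℝ}

lemma mono (hQ : OrderAtLeast Q d) (h : ∀ᶠ s in atTop, P s ≤ Q s) : OrderAtLeast P d :=
  fun d' hd' => (h.and (hQ d' hd')).mono fun _ hs => hs.1.trans hs.2

/-- Exponents strictly below `d` leave a spare power of `s`, which absorbs constants; logarithms
disappear in the same way. -/
lemma of_const_mul (h : ∀ d' < d, ∃ C : ℝ≥0∞, C ≠ ∞ ∧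
    ∀ᶠ s in atTop, P s ≤ C * ENNReal.ofReal (s ^ (-d'))) : OrderAtLeast P d := by
  intro d' hd'
  obtain ⟨d'', h1, h2⟩ := exists_between hd'
  obtain ⟨C, hC, hP⟩ := h d'' h2
  have hlim := (tendsto_rpow_atTop (sub_pos.2 h1)).eventually_ge_atTop C.toReal
  filter_upwards [hP, hlim, eventually_gt_atTop 0] with s hs hCs hs0
  refine hs.trans ?_
  rw [← ENNReal.ofReal_toReal hC, ← ENNReal.ofReal_mul ENNReal.toReal_nonneg]
  refine ENNReal.ofReal_le_ofReal ?_
  calc C.toReal * s ^ (-d'') ≤ s ^ (d'' - d') * s ^ (-d'') := by gcongr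
    _ = s ^ (-d') := by rw [← Real.rpow_add hs0]; ring_nf

lemma const_mul (hP : OrderAtLeast P d) {C : ℝ≥0∞} (hC : C ≠ ∞) :
    OrderAtLeast (fun s => C * P s) d :=
  of_const_mul fun d' hd' => ⟨C, hC, (hP d' hd').mono fun s hs => by gcongr⟩

lemma zero : OrderAtLeast (fun _ => 0) d := fun _ _ => by simp

lemma add (hP : OrderAtLeast P d) (hQ : OrderAtLeast Q d) :
    OrderAtLeast (fun s => P s + Q s) d :=
  of_const_mul fun d' hd' => ⟨2, by simp, ((hP d' hd').and (hQ d' hd')).mono fun s hs => by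
    rw [two_mul]
    exact add_le_add hs.1 hs.2⟩

lemma sum {ι : Type*} (t : Finset ι) {F : ι → ℝ → ℝ≥0∞} (h : ∀ i ∈ t, OrderAtLeast (F i) d) :
    OrderAtLeast (fun s => ∑ i ∈ t, F i s) d := by
  classical
  induction t using Finset.induction_on with
  | empty => simpa using zero
  | insert i t hi ih =>
    simp only [Finset.sum_insert hi]
    exact (h i (Finset.mem_insert_self _ _)).add
      (ih fun j hj => h j (Finset.mem_insert_of_mem hj))

lemma mul (hP : OrderAtLeast P d) (hQ : OrderAtLeast Q e) :
    OrderAtLeast (fun s => P s * Q s) (d + e) := by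
  intro d' hd'
  filter_upwards [hP (d - (d + e - d') / 2) (by linarith), hQ (e - (d + e - d') / 2) (by linarith),
    eventually_gt_atTop 0] with s h1 h2 hs
  refine (mul_le_mul' h1 h2).trans (le_of_eq ?_)
  rw [← ENNReal.ofReal_mul (by positivity), ← Real.rpow_add hs]
  ring_nf

end OrderAtLeast

/-! ### Orders of the elementary fading and noise events. -/

/-- The radius, relative to the square root of the energy, of the balls of unlikely fades. -/
def fadeRadius (s : ℝ) : ℝ := √(12 * Real.log s / s)

lemma orderAtLeast_fadeRadius_sq : OrderAtLeast (fun s => ENNReal.ofReal (fadeRadius s) ^ 2) 1 := by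
  refine OrderAtLeast.of_const_mul fun d' hd' => ⟨12, by simp, ?_⟩
  have h := (isLittleO_log_rpow_atTop (sub_pos.2 hd')).bound one_pos
  filter_upwards [h, eventually_ge_atTop 1] with s hs hs1
  have hlog := Real.log_nonneg hs1
  have hs0 : 0 < s := by linarith
  rw [fadeRadius, ← ENNReal.ofReal_pow (Real.sqrt_nonneg _), Real.sq_sqrt (by positivity),
    show (12 : ℝ≥0∞) = ENNReal.ofReal 12 by simp, ← ENNReal.ofReal_mul (by norm_num)]
  refine ENNReal.ofReal_le_ofReal ?_
  rw [one_mul, Real.norm_of_nonneg hlog, Real.norm_of_nonneg (by positivity)] at hs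
  rw [mul_div_assoc]
  gcongr
  calc Real.log s / s ≤ s ^ (1 - d') / s := by gcongr
    _ = s ^ (-d') := by
      rw [← Real.rpow_sub_one hs0.ne']
      ring_nf

lemma orderAtLeast_noise {k : ℝ} (hk : 0 < k) :
    OrderAtLeast (fun s => ((complexGaussian 1).prod (complexGaussian 1))
      {z | k * Real.log s ≤ ‖z.1‖ ^ 2 + ‖z.2‖ ^ 2}) k := by
  refine OrderAtLeast.of_const_mul fun d' hd' => ?_
  -- The Chernoff exponent `l * k` must exceed `d'` with `l < 1`, which is possible because `d' <
  -- k`.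
  obtain ⟨l, hl, hl1⟩ := exists_between (max_lt one_pos ((div_lt_one hk).2 hd'))
  obtain ⟨C, hC, h⟩ := exists_tail_bound_two (lt_of_le_of_lt (le_max_left _ _) hl) hl1
  refine ⟨C, hC, ?_⟩
  filter_upwards [eventually_ge_atTop 1] with s hs
  refine (h _).trans ?_
  gcongr
  have hd : d' < l * k := by
    rw [← div_lt_iff₀ hk]
    exact lt_of_le_of_lt (le_max_right _ _) hl
  rw [Real.rpow_def_of_pos (by linarith)]
  refine Real.exp_le_exp.2 ?_
  nlinarith [mul_nonneg (Real.log_nonneg hs) (sub_pos.2 hd).le]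

lemma orderAtLeast_noise_relay :
    OrderAtLeast (fun s => complexGaussian 1 {z | Real.log s ≤ ‖z‖ ^ 2}) 1 :=
  (orderAtLeast_noise one_pos).mono (.of_forall fun s => by
    simpa only [one_mul] using complexGaussian_tail_le (Real.log s))

/-! ### Small ball estimates for linear forms in the fades. -/

section SmallBall

variable {K : ℕ} {v : Fin K → ℝ≥0}

lemma exists_affine_closedBall_le {w : ℝ≥0} (hw : 0 < w) {e : ℂ} (he : e ≠ 0) :
    ∃ C : ℝ≥0∞, C ≠ ∞ ∧ ∀ (c : ℂ) (r : ℝ),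
      complexGaussian w {z | ‖c + z * e‖ ≤ r} ≤ C * ENNReal.ofReal r ^ 2 := by
  obtain ⟨C, hC, h⟩ := complexGaussian_closedBall_le hw
  have he' : 0 < ‖e‖ := norm_pos_iff.2 he
  refine ⟨C * ENNReal.ofReal (‖e‖⁻¹) ^ 2, by finiteness, fun c r => ?_⟩
  have h1 : {z | ‖c + z * e‖ ≤ r} ⊆ Metric.closedBall (-c / e) (‖e‖⁻¹ * r) := by
    intro z hz
    rw [Metric.mem_closedBall, dist_eq_norm, inv_mul_eq_div, le_div_iff₀ he', ← norm_mul]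
    refine le_trans (le_of_eq ?_) (show ‖c + z * e‖ ≤ r from hz)
    congr 1
    field_simp
    ring
  refine (measure_mono h1).trans ((h _ _).trans (le_of_eq ?_))
  rw [ENNReal.ofReal_mul (by positivity)]
  ring

lemma sum_update_mul (h e : Fin K → ℂ) (i : Fin K) (t : ℂ) :
    ∑ k, Function.update h i t k * e k = (∑ k ∈ Finset.univ.erase i, h k * e k) + t * e i := by
  rw [← Finset.sum_erase_add _ _ (Finset.mem_univ i), Function.update_self]
  congr 1
  exact Finset.sum_congr rfl fun k hk => by
    rw [Function.update_of_ne (Finset.ne_of_mem_erase hk)]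

/-- Small ball estimate for one coefficient, on an event that only involves the others. -/
lemma exists_pi_inter_le (hv : ∀ i, 0 < v i) {e : Fin K → ℂ} {i : Fin K} (he : e i ≠ 0) :
    ∃ C : ℝ≥0∞, C ≠ ∞ ∧ ∀ (B : Set (Fin K → ℂ)) (r : ℝ), MeasurableSet B →
      (∀ h t, Function.update h i t ∈ B ↔ h ∈ B) →
      Measure.pi (fun i => complexGaussian (v i)) ({h | ‖∑ k, h k * e k‖ ≤ r} ∩ B) ≤
        C * ENNReal.ofReal r ^ 2 * Measure.pi (fun i => complexGaussian (v i)) B := by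
  obtain ⟨C, hC, hle⟩ := exists_affine_closedBall_le (hv i) he
  refine ⟨C, hC, fun B r hB hBi => ?_⟩
  have hA : MeasurableSet {h : Fin K → ℂ | ‖∑ k, h k * e k‖ ≤ r} :=
    measurableSet_le (by fun_prop) (by fun_prop)
  set c := C * ENNReal.ofReal r ^ 2
  set G : (Fin K → ℂ) → ℝ≥0∞ := B.indicator fun _ => c with hG
  have hGm : Measurable G := measurable_const.indicator hB
  have hGu : ∀ h t, G (Function.update h i t) = G h := fun h t => by
    by_cases hh : h ∈ B <;> simp [hG, hBi, hh]
  -- Coordinate `i` is integrated first: `B` does not depend on it, and the remaining slice is a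
  -- disc for `h i`. The base point `0` is arbitrary.
  rw [← lintegral_indicator_one (hA.inter hB), ← lintegral_indicator_const hB,
    lintegral_eq_lmarginal_univ 0, lintegral_eq_lmarginal_univ 0,
    lmarginal_erase' _ (measurable_one.indicator (hA.inter hB)) (Finset.mem_univ i),
    lmarginal_erase' _ hGm (Finset.mem_univ i)]
  refine lmarginal_mono (fun h => ?_) 0
  simp only [hGu, lintegral_const, measure_univ, mul_one]
  by_cases hh : h ∈ B
  · rw [hG, Set.indicator_of_mem hh]
    refine le_trans (le_of_eq ?_) (hle (∑ k ∈ Finset.univ.erase i, h k * e k) r)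
    rw [← lintegral_indicator_one (measurableSet_le (by fun_prop) (by fun_prop))]
    refine lintegral_congr fun t => ?_
    simp only [Set.indicator, Set.mem_inter_iff, hBi, hh, and_true, Set.mem_ofPred_eq,
      sum_update_mul, Pi.one_apply]
  · simp [Set.indicator, hBi, hh]

lemma exists_pi_le (hv : ∀ i, 0 < v i) {e : Fin K → ℂ} {i : Fin K} (he : e i ≠ 0) :
    ∃ C : ℝ≥0∞, C ≠ ∞ ∧ ∀ r : ℝ,
      Measure.pi (fun i => complexGaussian (v i)) {h | ‖∑ k, h k * e k‖ ≤ r} ≤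
        C * ENNReal.ofReal r ^ 2 := by
  obtain ⟨C, hC, h⟩ := exists_pi_inter_le hv he
  refine ⟨C, hC, fun r => ?_⟩
  simpa using h Set.univ r .univ (by simp)

/-- Small ball estimate for a pair of linear forms of rank two. -/
lemma exists_pi_le_of_rank_two (hv : ∀ i, 0 < v i) {e e' : Fin K → ℂ} {i j : Fin K}
    (he : e i * e' j - e j * e' i ≠ 0) :
    ∃ C : ℝ≥0∞, C ≠ ∞ ∧ ∀ r : ℝ,
      Measure.pi (fun i => complexGaussian (v i))
        {h | ‖∑ k, h k * e k‖ ≤ r ∧ ‖∑ k, h k * e' k‖ ≤ r} ≤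
        C * (ENNReal.ofReal r ^ 2 * ENNReal.ofReal r ^ 2) := by
  -- Cramer elimination: `g'` does not involve coordinate `i`, while `g i` and `g' j` equal the
  -- nonzero minor up to sign. The two small-ball bounds can then be applied in succession.
  set g : Fin K → ℂ := fun k => e' j * e k - e j * e' k
  set g' : Fin K → ℂ := fun k => e i * e' k - e' i * e k
  have hg : g i ≠ 0 := by simpa [g, mul_comm] using he
  have hg' : g' j ≠ 0 := by simpa [g', mul_comm] using he
  have hg'i : g' i = 0 := by simp [g', mul_comm]
  obtain ⟨C, hC, h1⟩ := exists_pi_inter_le hv hg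
  obtain ⟨C', hC', h2⟩ := exists_pi_le hv hg'
  set q := ‖e i‖ + ‖e j‖ + ‖e' i‖ + ‖e' j‖
  have hq : 0 ≤ q := by positivity
  refine ⟨C * C' * ENNReal.ofReal q ^ 4, by finiteness, fun r => ?_⟩
  set B : Set (Fin K → ℂ) := {h | ‖∑ k, h k * g' k‖ ≤ q * r}
  have hB : MeasurableSet B := measurableSet_le (by fun_prop) (by fun_prop)
  have hBi : ∀ h t, Function.update h i t ∈ B ↔ h ∈ B := fun h t => by
    have : ∑ k, h k * g' k = ∑ k ∈ Finset.univ.erase i, h k * g' k := by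
      rw [← Finset.sum_erase_add _ _ (Finset.mem_univ i), hg'i, mul_zero, add_zero]
    simp only [B, Set.mem_ofPred_eq, sum_update_mul, hg'i, mul_zero, add_zero, this]
  have hsub : {h : Fin K → ℂ | ‖∑ k, h k * e k‖ ≤ r ∧ ‖∑ k, h k * e' k‖ ≤ r} ⊆
      {h | ‖∑ k, h k * g k‖ ≤ q * r} ∩ B := by
    rintro h ⟨ha, hb⟩
    have hr : 0 ≤ r := (norm_nonneg _).trans ha
    have bound : ∀ x y : ℂ, ‖x‖ + ‖y‖ ≤ q →
        ‖x * (∑ k, h k * e k) - y * (∑ k, h k * e' k)‖ ≤ q * r := fun x y hxy => by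
      refine (norm_sub_le _ _).trans ?_
      rw [norm_mul, norm_mul]
      calc _ ≤ ‖x‖ * r + ‖y‖ * r := by gcongr
        _ = (‖x‖ + ‖y‖) * r := by ring
        _ ≤ q * r := by gcongr
    have n1 := norm_nonneg (e i)
    have n2 := norm_nonneg (e j)
    have n3 := norm_nonneg (e' i)
    have n4 := norm_nonneg (e' j)
    constructor
    · have hu : ∑ k, h k * g k = e' j * (∑ k, h k * e k) - e j * (∑ k, h k * e' k) := by
        rw [Finset.mul_sum, Finset.mul_sum, ← Finset.sum_sub_distrib]
        exact Finset.sum_congr rfl fun k _ => by ring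
      rw [Set.mem_ofPred_eq, hu]
      exact bound _ _ (by linarith)
    · have hu : ∑ k, h k * g' k = -(e' i * (∑ k, h k * e k) - e i * (∑ k, h k * e' k)) := by
        rw [Finset.mul_sum, Finset.mul_sum, ← Finset.sum_sub_distrib, ← Finset.sum_neg_distrib]
        exact Finset.sum_congr rfl fun k _ => by ring
      simp only [B]
      rw [Set.mem_ofPred_eq, hu, norm_neg]
      exact bound _ _ (by linarith)
  refine (measure_mono hsub).trans ((h1 B _ hB hBi).trans ?_)
  refine (mul_le_mul_right (h2 (q * r)) _).trans (le_of_eq ?_)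
  rw [ENNReal.ofReal_mul hq]
  ring

end SmallBall

lemma prod_le_of_slice_le {α β : Type*} [MeasurableSpace α] [MeasurableSpace β]
    {μ : Measure α} {ν : Measure β} [SFinite ν] {A : Set α} {T : Set (α × β)} {c : ℝ≥0∞}
    (hA : MeasurableSet A) (hT : MeasurableSet T) (hTA : ∀ p ∈ T, p.1 ∈ A)
    (hc : ∀ x, ν {y | (x, y) ∈ T} ≤ c) : μ.prod ν T ≤ c * μ A := by
  rw [Measure.prod_apply hT, ← lintegral_indicator_const hA]
  refine lintegral_mono fun x => ?_
  by_cases hx : x ∈ A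
  · rw [Set.indicator_of_mem hx]
    exact hc x
  · rw [Set.indicator_of_notMem hx, nonpos_iff_eq_zero]
    convert measure_empty (μ := ν)
    exact Set.eq_empty_of_forall_notMem fun y hy => hx (hTA _ hy)

/-! ### Upper bound: what an error forces on the fades and the noise. -/

namespace Network

variable {K : ℕ} {N : Network K}

/-- The coordinatewise difference of two tuples of symbols. -/
def symbolDiff (x x' : N.Message) (k : Fin K) : ℂ := (x k : ℂ) - (x' k : ℂ)

lemma phase1_sub (s : ℝ) (h : Fin K → ℂ) (x x' : N.Message) :
    N.phase1 s h x - N.phase1 s h x' = (√s : ℂ) * ∑ k, h k * (N.a k * symbolDiff x x' k) := by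
  rw [phase1, phase1, ← Finset.sum_sub_distrib, Finset.mul_sum]
  exact Finset.sum_congr rfl fun k _ => by rw [symbolDiff]; ring

lemma phase2_sub (s : ℝ) (h : Fin K → ℂ) (q : ℂ) (x x' : N.Message) (r r' : N.S) :
    N.phase2 s h q x r - N.phase2 s h q x' r' =
      (√s : ℂ) * (∑ k, h k * (N.b k * symbolDiff x x' k) + q * ((r : ℂ) - r')) := by
  rw [phase2, phase2, add_sub_add_comm, ← Finset.sum_sub_distrib, mul_add, Finset.mul_sum]
  congr 1
  · exact Finset.sum_congr rfl fun k _ => by rw [symbolDiff]; ring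
  · ring

@[fun_prop]
lemma measurable_phase1 (s : ℝ) (x : N.Message) : Measurable fun h => N.phase1 s h x := by
  unfold phase1
  fun_prop

lemma exists_symbolDiff_ne_zero {x x' : N.Message} (h : x' ≠ x) : ∃ i, symbolDiff x x' i ≠ 0 := by
  obtain ⟨i, hi⟩ := Function.ne_iff.1 h
  exact ⟨i, fun h0 => hi (Subtype.ext (sub_eq_zero.1 h0).symm)⟩

lemma nonempty_ne (hS : 1 < N.S.card) (r : N.S) : Nonempty {r' : N.S // r' ≠ r} := by
  have : Nontrivial N.S := 
    Set.nontrivial_coe_sort.2 (Finset.one_lt_card_iff_nontrivial.1 hS)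
  obtain ⟨r', hr'⟩ := exists_ne r
  exact ⟨⟨r', hr'⟩⟩

/-- If the proposed decoder prefers `x'` to `x`, then the received signal is, up to `log SNR`, at
least as close to some codeword of `x'` as to the transmitted one. -/
lemma exists_symbol_of_metric_le (hS : 1 < N.S.card) {s : ℝ} (hs : 1 ≤ s) {h : Fin K → ℂ}
    {q y₁ y₂ : ℂ} {x x' : N.Message} (r : N.S)
    (hm : N.metric s h q y₁ y₂ x' ≤ N.metric s h q y₁ y₂ x) :
    ∃ r' : N.S,
      ‖y₁ - N.phase1 s h x'‖ ^ 2 + ‖y₂ - N.phase2 s h q x' r'‖ ^ 2 ≤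
        Real.log s + (‖y₁ - N.phase1 s h x‖ ^ 2 + ‖y₂ - N.phase2 s h q x r‖ ^ 2) ∧
      (r = N.f x → r' ≠ N.f x' →
        Real.log s ≤ ‖y₁ - N.phase1 s h x‖ ^ 2 + ‖y₂ - N.phase2 s h q x r‖ ^ 2) := by
  have hlog := Real.log_nonneg hs
  have hx : N.metric s h q y₁ y₂ x ≤
      Real.log s + (‖y₁ - N.phase1 s h x‖ ^ 2 + ‖y₂ - N.phase2 s h q x r‖ ^ 2) ∧
      (r = N.f x → N.metric s h q y₁ y₂ x ≤
        ‖y₁ - N.phase1 s h x‖ ^ 2 + ‖y₂ - N.phase2 s h q x r‖ ^ 2) := by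
    by_cases hr : r = N.f x
    · have h1 : N.metric s h q y₁ y₂ x ≤
          ‖y₁ - N.phase1 s h x‖ ^ 2 + ‖y₂ - N.phase2 s h q x r‖ ^ 2 := by
        rw [hr]
        exact min_le_left _ _
      exact ⟨by linarith, fun _ => h1⟩
    · refine ⟨(min_le_right _ _).trans ?_, fun h => absurd h hr⟩
      rw [m2]
      gcongr
      exact ciInf_le (f := fun r : {r : N.S // r ≠ N.f x} => ‖y₂ - N.phase2 s h q x r‖ ^ 2)
        (Set.finite_range _).bddBelow ⟨r, hr⟩
  rcases min_le_iff.1 (le_refl (N.metric s h q y₁ y₂ x')) with h1 | h1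
  · exact ⟨N.f x', h1.trans (hm.trans hx.1), fun _ h => absurd rfl h⟩
  -- With at least two symbols the infimum in `m2` is attained. In this branch `x'` pays the
  -- penalty, while a correct relay lets `x` avoid it.
  · have := nonempty_ne hS (N.f x')
    obtain ⟨⟨r', hr'⟩, he⟩ := exists_eq_ciInf_of_finite
      (f := fun r : {r : N.S // r ≠ N.f x'} => ‖y₂ - N.phase2 s h q x' r‖ ^ 2)
    rw [m2, ← he] at h1
    simp only at h1
    refine ⟨r', by linarith [hx.1], fun hr _ => ?_⟩
    have := hx.2 hr
    nlinarith [sq_nonneg ‖y₁ - N.phase1 s h x'‖, sq_nonneg ‖y₂ - N.phase2 s h q x' r'‖]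

/-- From `(A + B)² ≤ 2A² + 2B²` the factor `2·3 + 2·2 = 10` suffices, so the `12` in `fadeRadius`
leaves room. -/
lemma norm_le_fadeRadius {s : ℝ} (hs : 1 ≤ s) {d z : ℂ} (hz : ‖z‖ ^ 2 ≤ 2 * Real.log s)
    (h : ‖z + (√s : ℂ) * d‖ ^ 2 ≤ 3 * Real.log s) : ‖d‖ ≤ fadeRadius s := by
  have hs0 : 0 < s := by linarith
  have hlog := Real.log_nonneg hs
  refine Real.le_sqrt_of_sq_le ?_
  rw [le_div_iff₀ hs0]
  have h1 : ‖(√s : ℂ) * d‖ ^ 2 = ‖d‖ ^ 2 * s := by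
    rw [norm_mul, mul_pow, Complex.norm_real, Real.norm_of_nonneg (Real.sqrt_nonneg _),
      Real.sq_sqrt hs0.le, mul_comm]
  have h2 : ‖(√s : ℂ) * d‖ ≤ ‖z + (√s : ℂ) * d‖ + ‖z‖ := by
    simpa using norm_sub_le (z + (√s : ℂ) * d) z
  rw [← h1]
  nlinarith [sq_nonneg (‖z + (√s : ℂ) * d‖ - ‖z‖), norm_nonneg ((√s : ℂ) * d)]

/-- The law of the fading and the noise at the relay. -/
def relayLaw (N : Network K) : Measure ((Fin K → ℂ) × ℂ) :=
  (Measure.pi fun i => complexGaussian (N.varSR i)).prod (complexGaussian 1)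

/-- The law of the fading and the noise at the destination. -/
def destLaw (N : Network K) : Measure ((Fin K → ℂ) × ℂ × ℂ × ℂ) :=
  (Measure.pi fun i => complexGaussian (N.varSD i)).prod
    ((complexGaussian N.varRD).prod ((complexGaussian 1).prod (complexGaussian 1)))

instance : IsProbabilityMeasure N.relayLaw := by unfold relayLaw; infer_instance

instance : IsProbabilityMeasure N.destLaw := by unfold destLaw; infer_instance

instance : IsProbabilityMeasure N.law := by unfold law; infer_instance

lemma law_prod (A : Set ((Fin K → ℂ) × ℂ)) (B : Set ((Fin K → ℂ) × ℂ × ℂ × ℂ)) :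
    N.law (A ×ˢ B) = N.relayLaw A * N.destLaw B := Measure.prod_prod _ _

lemma destLaw_prod (A : Set (Fin K → ℂ)) (B : Set ℂ) (C : Set (ℂ × ℂ)) :
    N.destLaw (A ×ˢ B ×ˢ C) = Measure.pi (fun i => complexGaussian (N.varSD i)) A *
      (complexGaussian N.varRD B * ((complexGaussian 1).prod (complexGaussian 1)) C) := by
  rw [destLaw, Measure.prod_prod, Measure.prod_prod]

lemma orderAtLeast_pi {v : Fin K → ℝ≥0} (hv : ∀ i, 0 < v i) (ha : ∀ i, N.a i ≠ 0)
    {x x' : N.Message} (hx : x' ≠ x) :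
    OrderAtLeast (fun s => Measure.pi (fun i => complexGaussian (v i))
      {h | ‖∑ k, h k * (N.a k * symbolDiff x x' k)‖ ≤ fadeRadius s}) 1 := by
  obtain ⟨i, hi⟩ := exists_symbolDiff_ne_zero hx
  obtain ⟨C, hC, h⟩ := exists_pi_le hv (e := fun k => N.a k * symbolDiff x x' k)
    (mul_ne_zero (ha i) hi)
  exact (orderAtLeast_fadeRadius_sq.const_mul hC).mono (.of_forall fun s => h _)

/-- The maximum likelihood relay errs with order one. -/
lemma orderAtLeast_relay_error (hSR : ∀ i, 0 < N.varSR i) (ha : ∀ i, N.a i ≠ 0)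
    {δR : N.RelayRule} (hδR : δR.IsML) (x : N.Message) :
    OrderAtLeast (fun s => N.relayLaw {p | δR.decide s (p.1, N.phase1 s p.1 x + p.2) ≠ x}) 1 := by
  classical
  have h1 : ∀ x' ∈ (Finset.univ.filter fun x' : N.Message => x' ≠ x),
      OrderAtLeast (fun s => Measure.pi (fun i => complexGaussian (N.varSR i))
        {h | ‖∑ k, h k * (N.a k * symbolDiff x x' k)‖ ≤ fadeRadius s}) 1 :=
    fun x' hx' => orderAtLeast_pi hSR ha (Finset.mem_filter.1 hx').2
  refine (orderAtLeast_noise_relay.add (OrderAtLeast.sum _ h1)).mono ?_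
  filter_upwards [eventually_ge_atTop 1] with s hs
  have hlog := Real.log_nonneg hs
  have hsub : {p : (Fin K → ℂ) × ℂ | δR.decide s (p.1, N.phase1 s p.1 x + p.2) ≠ x} ⊆
      (Set.univ ×ˢ {z | Real.log s ≤ ‖z‖ ^ 2}) ∪
      ⋃ x' ∈ (Finset.univ.filter fun x' : N.Message => x' ≠ x),
        {h | ‖∑ k, h k * (N.a k * symbolDiff x x' k)‖ ≤ fadeRadius s} ×ˢ Set.univ := by
    rintro ⟨h, z⟩ hp
    by_cases hz : Real.log s ≤ ‖z‖ ^ 2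
    · exact Or.inl ⟨trivial, hz⟩
    · refine Or.inr (Set.mem_biUnion (Finset.mem_coe.2 (Finset.mem_filter.2
        ⟨Finset.mem_univ _, hp⟩)) ⟨?_, trivial⟩)
      rw [not_le] at hz
      have hml := hδR s (by linarith) h (N.phase1 s h x + z) x
      rw [add_sub_cancel_left, add_sub_right_comm, phase1_sub, add_comm] at hml
      refine norm_le_fadeRadius hs (z := z) (by linarith) ?_
      exact (pow_le_pow_left₀ (norm_nonneg _) hml 2).trans (by linarith)
  refine (measure_mono hsub).trans ((measure_union_le _ _).trans ?_)
  refine add_le_add ?_ ((measure_biUnion_finset_le _ _).trans (Finset.sum_le_sum fun x' _ => ?_))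
  · rw [relayLaw, Measure.prod_prod, measure_univ, one_mul]
  · rw [relayLaw, Measure.prod_prod, measure_univ, mul_one]

/-- The realisations for which the relay transmits `r` and the signal of `(x', r')` comes close to
the transmitted one, closer than it if `r` is correct and `r'` is not. -/
def confusion (δR : N.RelayRule) (x x' : N.Message) (r r' : N.S) (s : ℝ) : Set (Outcome K) :=
  {ω | relaySymbol δR s x ω.1.1 ω.1.2 = r ∧
    ‖∑ k, ω.2.1 k * (N.a k * symbolDiff x x' k)‖ ≤ fadeRadius s ∧
    ‖∑ k, ω.2.1 k * (N.b k * symbolDiff x x' k) + ω.2.2.1 * ((r : ℂ) - r')‖ ≤ fadeRadius s ∧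
    (r = N.f x → r' ≠ N.f x' → Real.log s ≤ ‖ω.2.2.2.1‖ ^ 2 + ‖ω.2.2.2.2‖ ^ 2)}

/-- The rank condition concerns only tuples `Δ` without zeros, whereas two messages may agree
somewhere. A constant `Δ` isolates a minor of `(a, b)` that no longer depends on `Δ`. -/
lemma a_mul_b_sub_ne_zero (hS : 1 < N.S.card) (hrank : N.FullRankSubmatrices) {i j : Fin K}
    (hij : i ≠ j) : N.a i * N.b j - N.a j * N.b i ≠ 0 := by
  obtain ⟨p, hp, p', hp', hne⟩ := Finset.one_lt_card.1 hS
  have hΔ : p - p' ≠ 0 := sub_ne_zero.2 hne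
  have h := hrank (fun _ => p - p') (fun _ => ⟨⟨p, hp, p', hp', rfl⟩, hΔ⟩) i j hij
  set M := (N.restrictedDiff fun _ => p - p').submatrix ![i, j] id with hM
  have hdet : M.det ≠ 0 := by
    intro h0
    obtain ⟨w, hw, hw0⟩ := Matrix.exists_mulVec_eq_zero_iff.2 h0
    have hsurj : Function.Surjective M.mulVecLin := by
      rw [← LinearMap.range_eq_top]
      exact Submodule.eq_top_of_finrank_eq (h.trans (by simp))
    exact hw (LinearMap.injective_iff_surjective.2 hsurj (by simpa using hw0))
  intro h0
  refine hdet ?_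
  rw [Matrix.det_fin_two]
  simp only [hM, Matrix.submatrix_apply, restrictedDiff, Matrix.of_apply, id]
  simp only [Matrix.cons_val_zero, Matrix.cons_val_one]
  linear_combination (p - p') ^ 2 * h0

lemma orderAtLeast_confusion (hS : 1 < N.S.card) (ha : ∀ i, N.a i ≠ 0)
    (hSR : ∀ i, 0 < N.varSR i) (hSD : ∀ i, 0 < N.varSD i) (hRD : 0 < N.varRD)
    (hlatin : N.IsLatinHypercube) (hrank : N.FullRankSubmatrices)
    {δR : N.RelayRule} (hδR : δR.IsML) {x x' : N.Message} (hx : x' ≠ x) (r r' : N.S) :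
    OrderAtLeast (fun s => N.law (confusion δR x x' r r' s)) 2 := by
  rw [← one_add_one_eq_two]
  have hd1 := orderAtLeast_pi hSD ha hx
  by_cases hr : r = N.f x
  swap
  · refine ((orderAtLeast_relay_error hSR ha hδR x).mul hd1).mono (.of_forall fun s => ?_)
    have hsub : confusion δR x x' r r' s ⊆
        {p | δR.decide s (p.1, N.phase1 s p.1 x + p.2) ≠ x} ×ˢ
        ({h | ‖∑ k, h k * (N.a k * symbolDiff x x' k)‖ ≤ fadeRadius s} ×ˢ
          Set.univ ×ˢ Set.univ) := by
      rintro ω ⟨h1, h2, -⟩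
      refine ⟨fun h => hr ?_, h2, trivial, trivial⟩
      rw [← h1, relaySymbol, h]
    refine (measure_mono hsub).trans (le_of_eq ?_)
    rw [law_prod, destLaw_prod, measure_univ, measure_univ, mul_one, mul_one]
  by_cases hrr : r = r'
  swap
  · obtain ⟨C, hC, hle⟩ := exists_affine_closedBall_le hRD (sub_ne_zero.2 (Subtype.coe_ne_coe.2 hrr))
    refine ((orderAtLeast_fadeRadius_sq.const_mul hC).mul hd1).mono (.of_forall fun s => ?_)
    set T : Set ((Fin K → ℂ) × ℂ × ℂ × ℂ) :=
      {p | ‖∑ k, p.1 k * (N.a k * symbolDiff x x' k)‖ ≤ fadeRadius s ∧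
        ‖∑ k, p.1 k * (N.b k * symbolDiff x x' k) + p.2.1 * ((r : ℂ) - r')‖ ≤ fadeRadius s}
    have hT : MeasurableSet T := by
      simp only [T, measurableSet_setOfPred]
      refine Measurable.and ?_ ?_ <;>
        exact measurableSet_setOfPred.1 (measurableSet_le (by fun_prop) (by fun_prop))
    have hsub : confusion δR x x' r r' s ⊆ Set.univ ×ˢ T := fun ω h => ⟨trivial, h.2.1, h.2.2.1⟩
    refine (measure_mono hsub).trans ?_
    rw [law_prod, measure_univ, one_mul]
    refine prod_le_of_slice_le (measurableSet_le (by fun_prop) (by fun_prop)) hT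
      (fun p hp => hp.1) fun h => le_trans ?_ (hle (∑ k, h k * (N.b k * symbolDiff x x' k)) _)
    refine (measure_mono (t := {z | ‖∑ k, h k * (N.b k * symbolDiff x x' k) +
      z * ((r : ℂ) - r')‖ ≤ fadeRadius s} ×ˢ Set.univ) fun p hp => ⟨hp.2, trivial⟩).trans ?_
    rw [Measure.prod_prod, measure_univ, mul_one]
  obtain ⟨i, hi⟩ := exists_symbolDiff_ne_zero hx
  by_cases hj : ∃ j, j ≠ i ∧ symbolDiff x x' j ≠ 0
  · obtain ⟨j, hji, hj⟩ := hj
    obtain ⟨C, hC, hle⟩ := exists_pi_le_of_rank_two hSD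
      (e := fun k => N.a k * symbolDiff x x' k) (e' := fun k => N.b k * symbolDiff x x' k)
      (i := i) (j := j) (by
        have := mul_ne_zero (mul_ne_zero hi hj) (a_mul_b_sub_ne_zero hS hrank hji.symm)
        refine fun h => this ?_
        linear_combination h)
    refine ((orderAtLeast_fadeRadius_sq.mul orderAtLeast_fadeRadius_sq).const_mul hC).mono
      (.of_forall fun s => le_trans ?_ (hle _))
    have hsub : confusion δR x x' r r' s ⊆ Set.univ ×ˢ
        ({h | ‖∑ k, h k * (N.a k * symbolDiff x x' k)‖ ≤ fadeRadius s ∧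
          ‖∑ k, h k * (N.b k * symbolDiff x x' k)‖ ≤ fadeRadius s} ×ˢ Set.univ ×ˢ Set.univ) := by
      rintro ω ⟨-, h2, h3, -⟩
      rw [hrr, sub_self, mul_zero, add_zero] at h3
      exact ⟨trivial, ⟨h2, h3⟩, trivial, trivial⟩
    refine (measure_mono hsub).trans (le_of_eq ?_)
    rw [law_prod, destLaw_prod, measure_univ, measure_univ, measure_univ, one_mul, mul_one, mul_one]
  · push Not at hj
    have hupd : x' = Function.update x i (x' i) := by
      refine Function.eq_update_iff.2 ⟨rfl, fun j hji => Subtype.ext ?_⟩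
      exact (sub_eq_zero.1 (hj j hji)).symm
    -- Here `r' = r = f x`, and `x'` differs from `x` only at `i`.
    have hne : r' ≠ N.f x' := by
      have h := hlatin x i (x i) (x' i) fun h => hi (by rw [symbolDiff, h, sub_self])
      rwa [Function.update_eq_self, ← hupd, ← hr, hrr] at h
    refine (hd1.mul (orderAtLeast_noise one_pos)).mono (.of_forall fun s => ?_)
    have hsub : confusion δR x x' r r' s ⊆ Set.univ ×ˢ
        ({h | ‖∑ k, h k * (N.a k * symbolDiff x x' k)‖ ≤ fadeRadius s} ×ˢ Set.univ ×ˢ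
          {z | 1 * Real.log s ≤ ‖z.1‖ ^ 2 + ‖z.2‖ ^ 2}) := by
      rintro ω ⟨-, h2, -, h4⟩
      exact ⟨trivial, h2, trivial, by simpa using h4 hr hne⟩
    refine (measure_mono hsub).trans (le_of_eq ?_)
    rw [law_prod, destLaw_prod, measure_univ, measure_univ, one_mul, one_mul]

/-- The proposed decoder errs with order two. -/
lemma orderAtLeast_error (hS : 1 < N.S.card) (ha : ∀ i, N.a i ≠ 0)
    (hSR : ∀ i, 0 < N.varSR i) (hSD : ∀ i, 0 < N.varSD i) (hRD : 0 < N.varRD)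
    (hlatin : N.IsLatinHypercube) (hrank : N.FullRankSubmatrices)
    {δR : N.RelayRule} {δD : N.DestRule} (hδR : δR.IsML) (hδD : δD.IsProposed) (x : N.Message) :
    OrderAtLeast (fun s => N.law {ω | decoded δR δD s x ω ≠ x}) 2 := by
  classical
  set I := Finset.univ.filter fun p : N.Message × N.S × N.S => p.1 ≠ x
  have h1 : ∀ p ∈ I, OrderAtLeast (fun s => N.law (confusion δR x p.1 p.2.1 p.2.2 s)) 2 :=
    fun p hp => orderAtLeast_confusion hS ha hSR hSD hRD hlatin hrank hδR
      (Finset.mem_filter.1 hp).2 _ _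
  refine ((orderAtLeast_noise two_pos).add (OrderAtLeast.sum _ h1)).mono ?_
  filter_upwards [eventually_ge_atTop 1] with s hs
  have hsub : {ω | decoded δR δD s x ω ≠ x} ⊆
      (Set.univ ×ˢ Set.univ ×ˢ Set.univ ×ˢ {z | 2 * Real.log s ≤ ‖z.1‖ ^ 2 + ‖z.2‖ ^ 2}) ∪
      ⋃ p ∈ I, confusion δR x p.1 p.2.1 p.2.2 s := by
    rintro ⟨⟨hR, zR⟩, h, q, z₁, z₂⟩ hω
    by_cases hz : 2 * Real.log s ≤ ‖z₁‖ ^ 2 + ‖z₂‖ ^ 2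
    · exact Or.inl ⟨trivial, trivial, trivial, hz⟩
    rw [not_le] at hz
    refine Or.inr ?_
    have hm := hδD s (by linarith) h q (N.phase1 s h x + z₁)
      (N.phase2 s h q x (relaySymbol δR s x hR zR) + z₂) x
    set r := relaySymbol δR s x hR zR
    obtain ⟨r', hr1, hr2⟩ := exists_symbol_of_metric_le hS hs r hm
    set x' := decoded δR δD s x ((hR, zR), h, q, z₁, z₂)
    change ‖N.phase1 s h x + z₁ - N.phase1 s h x'‖ ^ 2 +
      ‖N.phase2 s h q x r + z₂ - N.phase2 s h q x' r'‖ ^ 2 ≤ _ at hr1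
    rw [add_sub_cancel_left, add_sub_cancel_left] at hr1 hr2
    rw [add_sub_right_comm, add_sub_right_comm, phase1_sub, phase2_sub, add_comm _ z₁,
      add_comm _ z₂] at hr1
    have n1 := sq_nonneg ‖z₁‖
    have n2 := sq_nonneg ‖z₂‖
    refine Set.mem_biUnion (x := (x', r, r')) (Finset.mem_coe.2 (Finset.mem_filter.2
        ⟨Finset.mem_univ _, hω⟩)) ⟨rfl, ?_, ?_, hr2⟩
    · refine norm_le_fadeRadius hs (z := z₁) (by linarith) (le_trans ?_ (hr1.trans ?_))
      · exact le_add_of_nonneg_right (sq_nonneg _)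
      · linarith
    · refine norm_le_fadeRadius hs (z := z₂) (by linarith) (le_trans ?_ (hr1.trans ?_))
      · exact le_add_of_nonneg_left (sq_nonneg _)
      · linarith
  refine (measure_mono hsub).trans ((measure_union_le _ _).trans ?_)
  refine add_le_add (le_of_eq ?_) (measure_biUnion_finset_le _ _)
  rw [law_prod, destLaw_prod, measure_univ, measure_univ, measure_univ, one_mul, one_mul, one_mul]

end Network
-- Tools for the lower bounds.
lemma hasDiversityOrder_of_bounds {P : ℝ → ℝ} {d : ℝ}
    (hup : ∀ d' < d, ∀ᶠ s in atTop, P s ≤ s ^ (-d')) (hlow : DiversityOrderAtMost P d) :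
    HasDiversityOrder P d := by
  refine Metric.tendsto_nhds.2 fun ε hε => ?_
  filter_upwards [hup (d - ε / 2) (by linarith), hlow (ε / 2) (by linarith),
    eventually_gt_atTop 1] with s h1 h2 hs
  have hs0 : 0 < s := by linarith
  have hlog := Real.log_pos hs
  -- Positivity comes from the lower bound; without it `Real.log 0 = 0` would spoil the quotient.
  have hP : 0 < P s := lt_of_lt_of_le (by positivity) h2
  have h1' := Real.log_le_log hP h1
  have h2' := Real.log_le_log (by positivity) h2
  rw [Real.log_rpow hs0] at h1' h2'
  rw [Real.dist_eq, abs_lt]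
  constructor
  · rw [lt_sub_iff_add_lt, lt_div_iff₀ hlog]
    nlinarith
  · rw [sub_lt_iff_lt_add, div_lt_iff₀ hlog]
    nlinarith

lemma diversityOrderAtMost_of_le {Q : ℝ → ℝ≥0∞} {c : ℝ≥0∞} (hc : c ≠ 0) (hQ : ∀ s, Q s ≠ ∞)
    (h : ∀ᶠ s in atTop, c * (ENNReal.ofReal (√s)⁻¹ ^ 2 * ENNReal.ofReal (√s)⁻¹ ^ 2) ≤ Q s) :
    DiversityOrderAtMost (fun s => (Q s).toReal) 2 := by
  intro ε hε
  -- A finite positive `c'` replaces `c`, which might be infinite.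
  obtain ⟨c', hc'0, hc'⟩ := ENNReal.lt_iff_exists_nnreal_btwn.1 (pos_iff_ne_zero.2 hc)
  have hpos : (0 : ℝ) < c' := by exact_mod_cast hc'0
  filter_upwards [h, (tendsto_rpow_neg_atTop hε).eventually_le_const hpos,
    eventually_gt_atTop 0] with s h1 h2 hs
  rw [← ENNReal.ofReal_le_iff_le_toReal (hQ s)]
  refine le_trans ?_ h1
  refine le_trans ?_ (mul_le_mul_left hc'.le _)
  rw [← ENNReal.ofReal_coe_nnreal, ← ENNReal.ofReal_pow (by positivity),
    ← ENNReal.ofReal_mul (by positivity), ← ENNReal.ofReal_mul (by positivity)]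
  refine ENNReal.ofReal_le_ofReal ?_
  have h3 : ((√s)⁻¹ ^ 2 * (√s)⁻¹ ^ 2 : ℝ) = s ^ (-2 : ℝ) := by
    rw [inv_pow, Real.sq_sqrt hs.le, Real.rpow_neg hs.le, ← mul_inv]
    norm_cast
    rw [sq]
  rw [h3, neg_add, Real.rpow_add hs, mul_comm]
  gcongr

lemma le_prod_add_prod {α β : Type*} [MeasurableSpace α] [MeasurableSpace β]
    {μ : Measure α} {ν : Measure β} [SFinite ν] {A A' : Set (α × β)} {B : Set α} {c : ℝ≥0∞}
    (hA : MeasurableSet A) (hA' : MeasurableSet A') (hB : MeasurableSet B)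
    (h : ∀ x ∈ B, c ≤ ν (Prod.mk x ⁻¹' A) + ν (Prod.mk x ⁻¹' A')) :
    c * μ B ≤ μ.prod ν A + μ.prod ν A' := by
  rw [Measure.prod_apply hA, Measure.prod_apply hA', ← lintegral_add_left
    (measurable_measure_prodMk_left hA), ← lintegral_indicator_const hB]
  refine lintegral_mono fun x => ?_
  by_cases hx : x ∈ B
  · rw [Set.indicator_of_mem hx]
    exact h x hx
  · rw [Set.indicator_of_notMem hx]
    exact zero_le

lemma exists_dist_le (S : Finset ℂ) : ∃ D : ℝ, 0 ≤ D ∧ ∀ r r' : S, ‖(r : ℂ) - r'‖ ≤ D := by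
  refine ⟨∑ p : S × S, ‖(p.1 : ℂ) - p.2‖, by positivity, fun r r' => ?_⟩
  exact Finset.single_le_sum (f := fun p : S × S => ‖(p.1 : ℂ) - p.2‖)
    (fun _ _ => norm_nonneg _) (Finset.mem_univ (r, r'))

lemma norm_sqrt_mul_sub_le {s : ℝ} (hs : 0 < s) {g w : ℂ} {η : ℝ}
    (h : w ∈ Metric.closedBall ((√s : ℂ)⁻¹ * g) (η * (√s)⁻¹)) : ‖(√s : ℂ) * w - g‖ ≤ η := by
  have hs' : 0 < √s := Real.sqrt_pos.2 hs
  have hne : (√s : ℂ) ≠ 0 := by exact_mod_cast hs'.ne'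
  rw [Metric.mem_closedBall, dist_eq_norm, ← div_eq_mul_inv, le_div_iff₀ hs', mul_comm] at h
  refine le_trans (le_of_eq ?_) h
  rw [← abs_of_pos hs', ← Real.norm_eq_abs, ← Complex.norm_real, ← norm_mul, Complex.norm_real,
    Real.norm_eq_abs, abs_of_pos hs']
  congr 1
  field_simp

/-- The event says that `√s` times the fade is within `η` of `g`. For `s ≥ 1` these discs stay in
one bounded region, so their probability is at least of order `1/s`. -/
lemma exists_le_scaled_closedBall {v : ℝ≥0} (hv : 0 < v) (g : ℂ) {η : ℝ} (hη : 0 < η) :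
    ∃ c : ℝ≥0∞, c ≠ 0 ∧ ∀ s : ℝ, 1 ≤ s → c * ENNReal.ofReal (√s)⁻¹ ^ 2 ≤
      complexGaussian v (Metric.closedBall ((√s : ℂ)⁻¹ * g) (η * (√s)⁻¹)) := by
  obtain ⟨c, hc, h⟩ := exists_le_complexGaussian_closedBall hv (‖g‖ + η)
  refine ⟨c * ENNReal.ofReal η ^ 2, mul_ne_zero hc (by simp [hη]), fun s hs => ?_⟩
  refine le_trans (le_of_eq ?_) (h _ _ ?_)
  · rw [ENNReal.ofReal_mul hη.le]
    ring
  · have h1 : (√s)⁻¹ ≤ 1 := inv_le_one_of_one_le₀ (Real.one_le_sqrt.2 hs)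
    rw [norm_mul, norm_inv, Complex.norm_real, Real.norm_of_nonneg (Real.sqrt_nonneg _)]
    have := norm_nonneg g
    gcongr
    · exact mul_le_of_le_one_left this h1
    · exact mul_le_of_le_one_right hη.le h1

/-! ### Lower bounds on the error probability. -/

namespace Network

variable {K : ℕ} {N : Network K}

lemma sum_symbolDiff_update (h c : Fin K → ℂ) (x : N.Message) (i : Fin K) (p : N.S) :
    ∑ k, h k * (c k * symbolDiff x (Function.update x i p) k) =
      h i * (c i * ((x i : ℂ) - p)) := by
  rw [Finset.sum_eq_single i]
  · rw [symbolDiff, Function.update_self]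
  · intro k _ hk
    rw [symbolDiff, Function.update_of_ne hk, sub_self, mul_zero, mul_zero]
  · simp

/-- Both branches of the metric contain the phase 1 distance, and the penalty is nonnegative for `s
≥ 1`. -/
lemma le_metric {s : ℝ} (hs : 1 ≤ s) (h : Fin K → ℂ) (q y₁ y₂ : ℂ) (x : N.Message) :
    ‖y₁ - N.phase1 s h x‖ ^ 2 ≤ N.metric s h q y₁ y₂ x := by
  refine le_min (le_add_of_nonneg_right (sq_nonneg _)) ?_
  have h1 := Real.log_nonneg hs
  have h2 : 0 ≤ ⨅ r : {r : N.S // r ≠ N.f x}, ‖y₂ - N.phase2 s h q x r‖ ^ 2 :=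
    Real.iInf_nonneg fun _ => sq_nonneg _
  rw [m2]
  linarith

lemma pi_eval_preimage {v : Fin K → ℝ≥0} (i : Fin K) {B : Set ℂ} (hB : MeasurableSet B) :
    Measure.pi (fun i => complexGaussian (v i)) (Function.eval i ⁻¹' B) =
      complexGaussian (v i) B :=
  (measurePreserving_eval (fun i => complexGaussian (v i)) i).measure_preimage hB.nullMeasurableSet

/-- The error probability of the proposed decoder is at least of the order `SNR⁻²`. -/
lemma exists_le_error (hK : 0 < K) (hS : 1 < N.S.card) (ha : ∀ i, N.a i ≠ 0)
    (hSD : ∀ i, 0 < N.varSD i) (hRD : 0 < N.varRD)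
    (δR : N.RelayRule) {δD : N.DestRule} (hδD : δD.IsProposed) (x : N.Message) :
    ∃ c : ℝ≥0∞, c ≠ 0 ∧ ∀ s : ℝ, 1 ≤ s →
      c * (ENNReal.ofReal (√s)⁻¹ ^ 2 * ENNReal.ofReal (√s)⁻¹ ^ 2) ≤
        N.law {ω | decoded δR δD s x ω ≠ x} := by
  set i : Fin K := ⟨0, hK⟩
  obtain ⟨p, hp⟩ := nonempty_ne hS (x i)
  have hΔ : (x i : ℂ) - p ≠ 0 := sub_ne_zero.2 fun h => hp (Subtype.ext h.symm)
  set u := N.a i * ((x i : ℂ) - p) with hu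
  set w := N.b i * ((x i : ℂ) - p) with hw
  have hu0 : u ≠ 0 := mul_ne_zero (ha i) hΔ
  obtain ⟨D, hD0, hD⟩ := exists_dist_le N.S
  -- The event aims at `√s h_i = 2/u`, `√s h_RD = 0`, `z₁ = -2`, `z₂ = -(2/u)w`, where both
  -- residuals of `(x', f x')` vanish. Tolerance `η` keeps each residual below `1/4`, so `m₁(x') ≤
  -- 1/8`, while the metric of `x` is at least `(7/4)²`.
  set η : ℝ := (4 * (1 + ‖u‖ + ‖w‖ + D))⁻¹ with hηdef
  have hη : 0 < η := by positivity
  have hη1 : η * (1 + ‖u‖ + ‖w‖ + D) = 1 / 4 := by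
    rw [hηdef]
    field_simp
  obtain ⟨c₁, hc₁, h₁⟩ := exists_le_scaled_closedBall (hSD i) (2 / u) hη
  obtain ⟨c₂, hc₂, h₂⟩ := exists_le_scaled_closedBall hRD 0 hη
  obtain ⟨c₃, hc₃, h₃⟩ := exists_le_complexGaussian_closedBall one_pos (2 + η)
  obtain ⟨c₄, hc₄, h₄⟩ := exists_le_complexGaussian_closedBall one_pos (‖-(2 / u * w)‖ + η)
  refine ⟨c₁ * (c₂ * ((c₃ * ENNReal.ofReal η ^ 2) * (c₄ * ENNReal.ofReal η ^ 2))),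
    by simp [hc₁, hc₂, hc₃, hc₄, hη], fun s hs => ?_⟩
  have hs0 : 0 < s := by linarith
  have hsub : (Set.univ : Set ((Fin K → ℂ) × ℂ)) ×ˢ
      ((Function.eval i ⁻¹' Metric.closedBall ((√s : ℂ)⁻¹ * (2 / u)) (η * (√s)⁻¹)) ×ˢ
      Metric.closedBall ((√s : ℂ)⁻¹ * 0) (η * (√s)⁻¹) ×ˢ
      Metric.closedBall (-2 : ℂ) η ×ˢ Metric.closedBall (-(2 / u * w)) η) ⊆
      {ω | decoded δR δD s x ω ≠ x} := by
    rintro ⟨⟨hR, zR⟩, h, q, z₁, z₂⟩ ⟨-, hh, hq, hz₁, hz₂⟩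
    have e1 := norm_sqrt_mul_sub_le hs0 hh
    have e2 := norm_sqrt_mul_sub_le hs0 hq
    simp only [Function.eval, sub_zero] at e1 e2
    have e3 : ‖z₁ + 2‖ ≤ η := by simpa [dist_eq_norm] using hz₁
    have e4 : ‖z₂ + 2 / u * w‖ ≤ η := by simpa [dist_eq_norm] using hz₂
    set r := relaySymbol δR s x hR zR
    set x' : N.Message := Function.update x i p with hx'
    intro heq
    have hm := hδD s hs0 h q (N.phase1 s h x + z₁) (N.phase2 s h q x r + z₂) x'
    have hdec : δD.decide s (h, q, N.phase1 s h x + z₁, N.phase2 s h q x r + z₂) = x := heq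
    rw [hdec] at hm
    have hlow := (le_metric hs h q (N.phase1 s h x + z₁) (N.phase2 s h q x r + z₂) x).trans
      (hm.trans (min_le_left _ _))
    rw [m1, add_sub_cancel_left, add_sub_right_comm, add_sub_right_comm, phase1_sub, phase2_sub,
      hx', sum_symbolDiff_update, sum_symbolDiff_update, ← hu, ← hw, ← hx'] at hlow
    have f1 : ‖(√s : ℂ) * (h i * u) + z₁‖ ≤ 1 / 4 := by
      have : (√s : ℂ) * (h i * u) + z₁ = ((√s : ℂ) * h i - 2 / u) * u + (z₁ + 2) := by
        field_simp
        ring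
      rw [this]
      refine (norm_add_le _ _).trans ?_
      rw [norm_mul]
      have h1 : ‖(√s : ℂ) * h i - 2 / u‖ * ‖u‖ ≤ η * ‖u‖ := by gcongr
      have h2 : 0 ≤ η * ‖w‖ := by positivity
      have h3 : 0 ≤ η * D := by positivity
      linarith
    have f2 : ‖(√s : ℂ) * (h i * w + q * ((r : ℂ) - N.f x')) + z₂‖ ≤ 1 / 4 := by
      have : (√s : ℂ) * (h i * w + q * ((r : ℂ) - N.f x')) + z₂ =
          ((√s : ℂ) * h i - 2 / u) * w + (√s : ℂ) * q * ((r : ℂ) - N.f x') +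
            (z₂ + 2 / u * w) := by ring
      rw [this]
      refine (norm_add₃_le).trans ?_
      rw [norm_mul, norm_mul _ ((r : ℂ) - N.f x')]
      have h1 : ‖(√s : ℂ) * h i - 2 / u‖ * ‖w‖ ≤ η * ‖w‖ := by gcongr
      have h2 : ‖(√s : ℂ) * q‖ * ‖(r : ℂ) - N.f x'‖ ≤ η * D := by
        gcongr
        exact hD _ _
      have h3 : 0 ≤ η * ‖u‖ := by positivity
      linarith
    have f3 : 7 / 4 ≤ ‖z₁‖ := by
      have h1 : ‖(2 : ℂ)‖ ≤ ‖z₁ + 2‖ + ‖z₁‖ := by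
        simpa using norm_sub_le (z₁ + 2) z₁
      have h2 : η ≤ 1 / 4 := by
        have : 0 ≤ η * (‖u‖ + ‖w‖ + D) := by positivity
        linarith
      have h3 : ‖(2 : ℂ)‖ = 2 := by simp
      linarith
    nlinarith [norm_nonneg ((√s : ℂ) * (h i * u) + z₁),
      norm_nonneg ((√s : ℂ) * (h i * w + q * ((r : ℂ) - N.f x')) + z₂)]
  refine le_trans ?_ (measure_mono hsub)
  rw [law_prod, destLaw_prod, measure_univ, one_mul,
    pi_eval_preimage _ Metric.isClosed_closedBall.measurableSet, Measure.prod_prod]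
  refine le_trans (le_of_eq ?_) (mul_le_mul' (h₁ s hs) (mul_le_mul' (h₂ s hs)
    (mul_le_mul' (h₃ (-2) η (by simp)) (h₄ _ η le_rfl))))
  ring

lemma measurableSet_error (δR : N.RelayRule) (δD : N.DestRule) (s : ℝ) (x : N.Message) :
    MeasurableSet {ω | decoded δR δD s x ω ≠ x} := by
  have hr : Measurable fun p : (Fin K → ℂ) × ℂ => relaySymbol δR s x p.1 p.2 :=
    (Measurable.of_discrete (f := N.f)).comp ((δR.measurable_decide s).comp (by fun_prop))
  have hr' : Measurable fun ω : Outcome K => ((relaySymbol δR s x ω.1.1 ω.1.2 : N.S) : ℂ) :=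
    measurable_subtype_coe.comp (hr.comp measurable_fst)
  have hd : Measurable fun ω : Outcome K => decoded δR δD s x ω := by
    refine (δD.measurable_decide s).comp ?_
    unfold phase2
    fun_prop
  exact (measurableSet_singleton x).compl.preimage hd

/-- For all decision rules, two tuples that differ in one coordinate are confused with a
probability that is at least of the order `SNR⁻²`. -/
lemma exists_le_error_add_error (hSD : ∀ i, 0 < N.varSD i) (hRD : 0 < N.varRD)
    (x : N.Message) {i : Fin K} {p : N.S} (hp : p ≠ x i) :
    ∃ c : ℝ≥0∞, c ≠ 0 ∧ ∀ (δR : N.RelayRule) (δD : N.DestRule) (s : ℝ), 1 ≤ s →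
      c * (ENNReal.ofReal (√s)⁻¹ ^ 2 * ENNReal.ofReal (√s)⁻¹ ^ 2) ≤
        N.law {ω | decoded δR δD s x ω ≠ x} +
        N.law {ω | decoded δR δD s (Function.update x i p) ω ≠ Function.update x i p} := by
  set x' : N.Message := Function.update x i p with hx'
  have hxx : x ≠ x' := fun h => hp (by rw [h, hx', Function.update_self])
  set u := N.a i * ((x i : ℂ) - p) with hu
  set w := N.b i * ((x i : ℂ) - p) with hw
  obtain ⟨D, hD0, hD⟩ := exists_dist_le N.S
  obtain ⟨c₀, hc₀, h₀⟩ := exists_two_point_bound (‖u‖ + ‖w‖ + D)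
  obtain ⟨c₁, hc₁, h₁⟩ := exists_le_scaled_closedBall (hSD i) 0 one_pos
  obtain ⟨c₂, hc₂, h₂⟩ := exists_le_scaled_closedBall hRD 0 one_pos
  refine ⟨c₀ * c₂ * c₁, by simp [hc₀, hc₁, hc₂], fun δR δD s hs => ?_⟩
  have hs0 : 0 < s := by linarith
  have hA := measurableSet_error δR δD s x
  have hA' := measurableSet_error δR δD s x'
  set A := {ω | decoded δR δD s x ω ≠ x}
  set A' := {ω | decoded δR δD s x' ω ≠ x'}
  set B₁ := Metric.closedBall ((√s : ℂ)⁻¹ * 0) (1 * (√s)⁻¹)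
  have hB₁ : MeasurableSet B₁ := Metric.isClosed_closedBall.measurableSet
  have key : c₀ * complexGaussian N.varRD B₁ *
      Measure.pi (fun i => complexGaussian (N.varSD i)) (Function.eval i ⁻¹' B₁) *
      N.relayLaw Set.univ ≤ N.law A + N.law A' := by
    -- Both error events are sliced at the same relay realisation and fades, leaving only
    -- destination noise. The relay symbols `r`, `r'` are then fixed; they may differ, but `√s h_RD`
    -- is bounded by one.
    refine le_prod_add_prod hA hA' .univ fun ωR _ => ?_
    have hmR : Measurable (Prod.mk ωR : _ → Outcome K) := measurable_prodMk_left
    refine le_prod_add_prod (hA.preimage hmR) (hA'.preimage hmR)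
      (hB₁.preimage (measurable_pi_apply i)) fun h hh => ?_
    have hmh : Measurable (Prod.mk h : ℂ × ℂ × ℂ → (Fin K → ℂ) × ℂ × ℂ × ℂ) :=
      measurable_prodMk_left
    refine le_prod_add_prod ((hA.preimage hmR).preimage hmh) ((hA'.preimage hmR).preimage hmh)
      hB₁ fun q hq => ?_
    set r := relaySymbol δR s x ωR.1 ωR.2
    set r' := relaySymbol δR s x' ωR.1 ωR.2
    have e1 := norm_sqrt_mul_sub_le hs0 hh
    have e2 := norm_sqrt_mul_sub_le hs0 hq
    simp only [Function.eval, sub_zero] at e1 e2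
    have hdist : dist (N.phase1 s h x, N.phase2 s h q x r)
        (N.phase1 s h x', N.phase2 s h q x' r') ≤ ‖u‖ + ‖w‖ + D := by
      have h1 : ‖(√s : ℂ) * (h i * u)‖ ≤ ‖u‖ := by
        rw [← mul_assoc, norm_mul]
        exact mul_le_of_le_one_left (norm_nonneg _) e1
      have h2 : ‖(√s : ℂ) * (h i * w + q * ((r : ℂ) - r'))‖ ≤ ‖w‖ + D := by
        rw [mul_add, ← mul_assoc _ (h i) w, ← mul_assoc _ q]
        refine (norm_add_le _ _).trans ?_
        rw [norm_mul _ w, norm_mul _ ((r : ℂ) - r')]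
        refine add_le_add ?_ ?_
        · exact mul_le_of_le_one_left (norm_nonneg _) e1
        · refine le_trans ?_ (hD r r')
          exact mul_le_of_le_one_left (norm_nonneg _) e2
      rw [Prod.dist_eq, dist_eq_norm, dist_eq_norm, phase1_sub, phase2_sub, hx',
        sum_symbolDiff_update, sum_symbolDiff_update, ← hu, ← hw]
      exact max_le (by linarith [norm_nonneg w]) (by linarith [norm_nonneg u])
    have hmq : Measurable fun y : ℂ × ℂ => (h, q, y) := by fun_prop
    refine (h₀ _ _ hdist {y | δD.decide s (h, q, y) ≠ x} ((measurableSet_singleton x).compl.preimage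
      ((δD.measurable_decide s).comp hmq))).trans (add_le_add le_rfl (measure_mono fun z hz => ?_))
    -- Deciding `x` when `x'` was sent is an error for `x'`.
    have hz' : δD.decide s (h, q, (N.phase1 s h x', N.phase2 s h q x' r') + z) = x := not_not.1 hz
    exact fun hdec => hxx (hz'.symm.trans hdec)
  refine le_trans ?_ key
  rw [measure_univ, mul_one, pi_eval_preimage _ hB₁]
  calc _ = c₀ * (c₂ * ENNReal.ofReal (√s)⁻¹ ^ 2) * (c₁ * ENNReal.ofReal (√s)⁻¹ ^ 2) := by ring
    _ ≤ _ := by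
      gcongr
      · exact h₂ s hs
      · exact h₁ s hs

/-- No decision rules achieve a diversity order above two. -/
lemma diversityOrderAtMost_avgErrorProb (hK : 0 < K) (hS : 1 < N.S.card)
    (hSD : ∀ i, 0 < N.varSD i) (hRD : 0 < N.varRD) (δR : N.RelayRule) (δD : N.DestRule) :
    DiversityOrderAtMost (avgErrorProb δR δD) 2 := by
  have hne : Nonempty N.S := (Finset.card_pos.1 (by omega : 0 < N.S.card)).to_subtype
  set x : N.Message := Classical.arbitrary _
  set i : Fin K := ⟨0, hK⟩
  obtain ⟨p, hp⟩ := nonempty_ne hS (x i)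
  set x' : N.Message := Function.update x i p with hx'
  have hxx : x ≠ x' := fun h => hp (by rw [h, hx', Function.update_self])
  obtain ⟨c, hc, h⟩ := exists_le_error_add_error hSD hRD x hp
  have hcard : (Fintype.card N.Message : ℝ≥0∞) ≠ 0 := Nat.cast_ne_zero.2 Fintype.card_ne_zero
  have hcard' : (Fintype.card N.Message : ℝ≥0∞) ≠ ∞ := by simp
  have heq : avgErrorProb δR δD = fun s =>
      ((∑ x : N.Message, N.law {ω | decoded δR δD s x ω ≠ x}) / Fintype.card N.Message).toReal := by
    ext s
    rw [ENNReal.toReal_div, ENNReal.toReal_sum fun _ _ => measure_ne_top _ _]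
    rfl
  rw [heq]
  refine diversityOrderAtMost_of_le (c := c / Fintype.card N.Message)
    (ENNReal.div_ne_zero.2 ⟨hc, hcard'⟩)
    (fun s => ENNReal.div_ne_top (ENNReal.sum_ne_top.2 fun _ _ => measure_ne_top _ _) hcard) ?_
  filter_upwards [eventually_ge_atTop 1] with s hs
  rw [ENNReal.div_eq_inv_mul, ENNReal.div_eq_inv_mul, mul_assoc]
  gcongr
  refine (h δR δD s hs).trans ?_
  classical
  rw [← Finset.sum_pair (f := fun x => N.law {ω | decoded δR δD s x ω ≠ x}) hxx]
  exact Finset.sum_le_sum_of_subset (Finset.subset_univ _)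

end Network

end MARC

end

/-! ### Assembly of the matching bounds. -/

theorem theorem1 {K : ℕ} (hK : 0 < K) (N : MARC.Network K)
    (hS : 1 < N.S.card)
    (hnorm : ∀ i, ‖N.a i‖ ^ 2 + ‖N.b i‖ ^ 2 = 1)
    (ha : ∀ i, N.a i ≠ 0)
    (hSR : ∀ i, 0 < N.varSR i) (hSD : ∀ i, 0 < N.varSD i) (hRD : 0 < N.varRD)
    (hlatin : N.IsLatinHypercube)
    (hrank : N.FullRankSubmatrices) :
    (∀ (δR : N.RelayRule) (δD : N.DestRule), δR.IsML → δD.IsProposed →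
      (∀ x : N.Message, MARC.HasDiversityOrder (MARC.Network.errorProb δR δD x) 2) ∧
      MARC.HasDiversityOrder (MARC.Network.avgErrorProb δR δD) 2) ∧
    (∀ (δR : N.RelayRule) (δD : N.DestRule),
      MARC.DiversityOrderAtMost (MARC.Network.avgErrorProb δR δD) 2) := by
  have hlow := MARC.Network.diversityOrderAtMost_avgErrorProb (N := N) hK hS hSD hRD
  refine ⟨fun δR δD hδR hδD => ?_, hlow⟩
  have hup : ∀ (x : N.Message), ∀ d' < (2 : ℝ), ∀ᶠ s in atTop,
      MARC.Network.errorProb δR δD x s ≤ s ^ (-d') := fun x d' hd' => by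
    filter_upwards [MARC.Network.orderAtLeast_error hS ha hSR hSD hRD hlatin hrank hδR hδD x d' hd',
      eventually_ge_atTop 0] with s hs hs0
    exact ENNReal.toReal_le_of_le_ofReal (by positivity) hs
  refine ⟨fun x => MARC.hasDiversityOrder_of_bounds (hup x) ?_,
    MARC.hasDiversityOrder_of_bounds (fun d' hd' => ?_) (hlow δR δD)⟩
  · obtain ⟨c, hc, h⟩ := MARC.Network.exists_le_error hK hS ha hSD hRD δR hδD x
    exact MARC.diversityOrderAtMost_of_le hc (fun _ => measure_ne_top _ _)
      ((eventually_ge_atTop 1).mono h)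
  · have hne : Nonempty N.S := (Finset.card_pos.1 (by omega : 0 < N.S.card)).to_subtype
    filter_upwards [eventually_all.2 fun x => hup x d' hd'] with s hs
    rw [MARC.Network.avgErrorProb, div_le_iff₀ (by exact_mod_cast Fintype.card_pos), mul_comm]
    refine (Finset.sum_le_card_nsmul _ _ _ fun x _ => hs x).trans (le_of_eq ?_)
    rw [Finset.card_univ, nsmul_eq_mul]
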